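/- Let $\mathcal Q$ be one of the eight uniform tilings of the Euclidean plane. That is, $\mathcal Q$ is a locally finite edge-to-edge tiling of the plane by regular convex polygons whose symmetry group is transitive on the vertices, and, for one of the symbols $$p_1.p_2.\cdots.p_n\in\{3.6.3.6,\ 4.8.8,\ 3.12.12,\ 3.4.6.4,\ 3.3.3.4.4,\ 3.3.4.3.4,\ 4.6.12,\ 3.3.3.3.6\},$$ every vertex of $\mathcal Q$ is surrounded by exactly $n$ tiles which, listed in cyclic order, have $p_1,\dots,p_n$ sides (up to the choice of the starting tile and of the direction). Let $m$ be any positive common multiple of $p_1,\dots,p_n$ (for example their least common multiple), and let $$\Gamma=[m,n]=\langle \rho_0,\rho_1,\rho_2 \mid \rho_0^2=\rho_1^2=\rho_2^2=(\rho_0\rho_2)^2=(\rho_0\rho_1)^m=(\rho_1\rho_2)^n=\varepsilon\rangle .$$ A flag of $\mathcal Q$ is an incident triple (vertex, edge, tile), and the $i$-adjacent flag $\Psi^i$ of a flag $\Psi$ is the flag that differs from $\Psi$ exactly in its vertex ($i=0$), its edge ($i=1$) or its tile ($i=2$). Then $\Gamma$ acts from the right on the flags of $\mathcal Q$ by $\Psi\rho_i=\Psi^i$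 for $i=0,1,2$, and, for every flag $\Phi$ of $\mathcal Q$, the stabilizer $\mathrm{Stab}_\Gamma(\Phi)=\{w\in\Gamma : \Phi w=\Phi\}$ has no finite generating set. -/

import Mathlib

noncomputable section

/-- An indexed family of regular convex polygons in the Euclidean plane (modelled by `ℂ`).
The polygon `i` has `sides i` sides and centre `center i`, and `radius i` is the (nonzero) vector
from the centre to one of the vertices. -/
structure RegularPolygons (ι : Type*) where
  sides : ι → ℕ
  center : ι → ℂ
  radius : ι → ℂ
  three_le_sides : ∀ i, 3 ≤ sides i
  radius_ne_zero : ∀ i, radius i ≠ 0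

namespace RegularPolygons

variable {ι : Type*} (P : RegularPolygons ι)

/-- The vertices of the polygon `i` in cyclic order, periodic in `k` with period `sides i`. -/
def vert (i : ι) (k : ℤ) : ℂ :=
  P.center i + P.radius i * Complex.exp (2 * Real.pi * Complex.I * k / P.sides i)

/-- The polygon `i` as a closed subset of the plane. -/
def tile (i : ι) : Set ℂ := convexHull ℝ (Set.range (P.vert i))

/-- The edges of the polygon `i`; an edge is recorded as the unordered pair of its endpoints. -/
def edges (i : ι) : Set (Sym2 ℂ) := Set.range fun k : ℤ => s(P.vert i k, P.vert i (k + 1))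

end RegularPolygons

/-- An edge-to-edge tiling of the Euclidean plane by regular convex polygons. -/
structure RegularPolygonTiling (ι : Type*) extends RegularPolygons ι where
  covers : ⋃ i, toRegularPolygons.tile i = Set.univ
  interiors_disjoint : Pairwise fun i j =>
    Disjoint (interior (toRegularPolygons.tile i)) (interior (toRegularPolygons.tile j))
  locallyFinite : LocallyFinite toRegularPolygons.tile
  /-- Two distinct tiles are disjoint, or meet in exactly one common vertex,
  or meet in exactly one common edge. -/
  edge_to_edge : Pairwise fun i j =>
    toRegularPolygons.tile i ∩ toRegularPolygons.tile j = ∅ ∨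
    (∃ v : ℂ, v ∈ Set.range (toRegularPolygons.vert i) ∧
      v ∈ Set.range (toRegularPolygons.vert j) ∧
      toRegularPolygons.tile i ∩ toRegularPolygons.tile j = {v}) ∨
    (∃ v w : ℂ, s(v, w) ∈ toRegularPolygons.edges i ∧ s(v, w) ∈ toRegularPolygons.edges j ∧
      toRegularPolygons.tile i ∩ toRegularPolygons.tile j = segment ℝ v w)

namespace RegularPolygonTiling

variable {ι : Type*} (T : RegularPolygonTiling ι)

/-- The vertices of the tiling. -/
def vertices : Set ℂ := {v | ∃ i, v ∈ Set.range (T.vert i)}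

/-- A symmetry of the tiling: an isometry of the plane that maps tiles onto tiles. -/
def IsSymmetry (g : ℂ ≃ᵢ ℂ) : Prop :=
  (fun S : Set ℂ => g '' S) '' Set.range T.tile = Set.range T.tile

/-- The symmetry group of the tiling is transitive on the vertices. -/
def IsVertexTransitive : Prop :=
  ∀ v ∈ T.vertices, ∀ w ∈ T.vertices, ∃ g : ℂ ≃ᵢ ℂ, T.IsSymmetry g ∧ g v = w

/-- The tiling has vertex symbol `p₁.p₂.….pₙ`: every vertex `v` is surrounded by exactly `n`
tiles `f₁, …, fₙ`, listed in cyclic order (cyclically consecutive tiles share an edge at `v`),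
where `fⱼ` has `pⱼ` sides. -/
def HasVertexSymbol (p : List ℕ) : Prop :=
  ∀ v ∈ T.vertices, ∃ f : Fin p.length → ι,
    Function.Injective f ∧
    Set.range f = {i | v ∈ Set.range (T.vert i)} ∧
    (∀ j, T.sides (f j) = p.get j) ∧
    ∀ j, ∃ e : Sym2 ℂ, v ∈ e ∧ e ∈ T.edges (f j) ∧ e ∈ T.edges (f (finRotate p.length j))

/-- The flags of the polyhedron given by the tiling: incident triples of a vertex,
an edge and a tile. -/
@[ext]
structure Flag where
  vertex : ℂ
  edge : Sym2 ℂ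
  face : ι
  vertex_mem : vertex ∈ edge
  edge_mem : edge ∈ T.edges face

/-- `Ψ'` is `i`-adjacent to `Ψ`: the two flags differ in rank `i` and in no other rank. -/
def Adjacent (i : Fin 3) (Ψ Ψ' : T.Flag) : Prop :=
  (Ψ'.vertex = Ψ.vertex ↔ i ≠ 0) ∧ (Ψ'.edge = Ψ.edge ↔ i ≠ 1) ∧ (Ψ'.face = Ψ.face ↔ i ≠ 2)

end RegularPolygonTiling

/-- The symbols of the eight uniform tilings. -/
def uniformSymbols : List (List ℕ) :=
  [[3, 6, 3, 6], [4, 8, 8], [3, 12, 12], [3, 4, 6, 4], [3, 3, 3, 4, 4], [3, 3, 4, 3, 4],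
    [4, 6, 12], [3, 3, 3, 3, 6]]

/-- The uniform tiling with a given symbol. -/
def RegularPolygonTiling.IsUniform {ι : Type*} (T : RegularPolygonTiling ι) (p : List ℕ) : Prop :=
  p ∈ uniformSymbols ∧ T.IsVertexTransitive ∧ T.HasVertexSymbol p

/-- The defining relators of the Coxeter group `[m, n]`. -/
def coxeterRels (m n : ℕ) : Set (FreeGroup (Fin 3)) :=
  {FreeGroup.of 0 ^ 2, FreeGroup.of 1 ^ 2, FreeGroup.of 2 ^ 2,
    (FreeGroup.of 0 * FreeGroup.of 2) ^ 2,
    (FreeGroup.of 0 * FreeGroup.of 1) ^ m,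
    (FreeGroup.of 1 * FreeGroup.of 2) ^ n}

/-- The Coxeter group `[m, n]`, generated by three involutions `ρ₀, ρ₁, ρ₂` subject to
`(ρ₀ρ₂)² = (ρ₀ρ₁)ᵐ = (ρ₁ρ₂)ⁿ = 1`. -/
abbrev CoxeterMN (m n : ℕ) : Type := PresentedGroup (coxeterRels m n)

/-- The distinguished generators of `[m, n]`. -/
def CoxeterMN.rho (m n : ℕ) (i : Fin 3) : CoxeterMN m n := PresentedGroup.of i

namespace RegularPolygonTiling

variable {ι : Type*} (T : RegularPolygonTiling ι) {m n : ℕ}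

/-- `φ` is the flag action of `[m, n]` on the tiling. It is a right action, that is, a homomorphism
to the opposite of the group of permutations of the flags, and each generator `ρᵢ` takes every flag
to its `i`-adjacent flag. -/
def IsFlagAction (φ : CoxeterMN m n →* (Equiv.Perm T.Flag)ᵐᵒᵖ) : Prop :=
  ∀ (i : Fin 3) (Ψ : T.Flag), T.Adjacent i Ψ ((φ (CoxeterMN.rho m n i)).unop Ψ)

/-- The stabilizer of the flag `Φ`. -/
def flagStabilizer (φ : CoxeterMN m n →* (Equiv.Perm T.Flag)ᵐᵒᵖ) (Φ : T.Flag) :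
    Subgroup (CoxeterMN m n) where
  carrier := {w | (φ w).unop Φ = Φ}
  mul_mem' := by
    intro a b ha hb
    simp only [Set.mem_ofPred_eq] at ha hb ⊢
    rw [map_mul, MulOpposite.unop_mul, Equiv.Perm.mul_apply, ha, hb]
  one_mem' := by simp
  inv_mem' := by
    intro a ha
    simp only [Set.mem_ofPred_eq] at ha ⊢
    rw [map_inv, MulOpposite.unop_inv, Equiv.Perm.inv_eq_iff_eq, ha]

end RegularPolygonTiling

end

/-!
Why the stabilizers are not finitely generated: `[m, n]` is the orbifold fundamental group of a
triangle, and the stabilizer of a flag is that of the plane with a cone point of order `m / p` at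
the centre of each tile with `p` sides. Infinitely many of these orders exceed `1`, because each
vertex lies on a tile with fewer than `m` sides.

The cone points are detected by winding numbers. For a tile `f` with `p` sides, the angle at the
centre of `f` swept by the vertex of a flag, as the flag moves along a word in the generators, is
well defined on `[m, n]` modulo `m / p` full turns. Indeed the relators of types `(ρ₀ρ₂)²` and
`(ρ₁ρ₂)ⁿ` sweep no angle, and `(ρ₀ρ₁)ᵐ`, based at a flag of the tile `g`, goes `m / sides g` times
around `g`, which sweeps no angle if `g ≠ f`, since `g` is convex and does not contain the centre
of `f` (`exists_arg_div_eq_sub`, `center_notMem_tile`), and `m / p` turns if `g = f`. This is encoded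
as an action of `[m, n]` on the product of the flags and a circle of length `2π * (m / p)`
(`skewPerm`, `exists_skewAction`, `isPeriodicCocycle_angleIncrement`).

The paths of finitely many elements of the stabilizer of `Φ` stay in a disc (`exists_radius`), and
there is a tile `f` with fewer than `m` sides and its centre outside of this disc
(`infinite_sides_lt`). Around this centre the elements do not wind. But since the flag graph is
connected (`mem_of_adjacent_closed`), the stabilizer contains an element that goes to `f`, once
around `f` and back, and this is not a multiple of `m / p` turns.

That the action exists rests on the uniqueness of adjacent flags. The centre of a tile lies in no
other tile, so that two tiles on the same side of a common edge coincide and an edge is on at most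
two tiles (`eq_or_eq_or_eq_of_mem_edges`). The vertex symbol then shows that each edge is on exactly
two tiles, and that the flags at a vertex form one cycle of length `2n` (`exists_flags_at`).
-/

noncomputable section

/-! ### Regular polygons -/

namespace RegularPolygons

variable {ι : Type*} (P : RegularPolygons ι)

lemma sides_pos (i : ι) : 0 < P.sides i := lt_of_lt_of_le (by norm_num) (P.three_le_sides i)

lemma sides_ne_zero (i : ι) : (P.sides i : ℂ) ≠ 0 := by
  exact_mod_cast (P.sides_pos i).ne'

lemma vert_eq_vert_iff (i : ι) (k l : ℤ) :
    P.vert i k = P.vert i l ↔ (P.sides i : ℤ) ∣ k - l := by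
  have h0 := P.sides_ne_zero i
  have h2 : (2 * Real.pi * Complex.I : ℂ) ≠ 0 := Complex.two_pi_I_ne_zero
  unfold vert
  rw [add_right_inj, mul_right_inj' (P.radius_ne_zero i), Complex.exp_eq_exp_iff_exists_int]
  constructor
  · rintro ⟨n, hn⟩
    refine ⟨n, ?_⟩
    have h : (2 * Real.pi * Complex.I : ℂ) * k = (2 * Real.pi * Complex.I) * (l + P.sides i * n) := by
      field_simp at hn ⊢
      linear_combination hn
    have := mul_left_cancel₀ h2 h
    have h' : k = l + P.sides i * n := by exact_mod_cast this
    rw [h']; ring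
  · rintro ⟨n, hn⟩
    refine ⟨n, ?_⟩
    have h' : k = l + P.sides i * n := by rw [← hn]; ring
    rw [h']; push_cast; field_simp

lemma vert_add_mul_sides (i : ι) (k n : ℤ) : P.vert i (k + P.sides i * n) = P.vert i k :=
  (P.vert_eq_vert_iff i _ _).2 ⟨n, by ring⟩

lemma vert_ne_vert_add_one (i : ι) (k : ℤ) : P.vert i k ≠ P.vert i (k + 1) := by
  rw [Ne, P.vert_eq_vert_iff]
  intro h
  have h3 := P.three_le_sides i
  have := Int.le_of_dvd (by norm_num) ((dvd_neg.2 h).trans (dvd_of_eq (by ring : -(k - (k + 1)) = 1)))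
  omega

lemma vert_sub_one_ne_vert_add_one (i : ι) (k : ℤ) : P.vert i (k - 1) ≠ P.vert i (k + 1) := by
  rw [Ne, P.vert_eq_vert_iff]
  intro h
  have h3 := P.three_le_sides i
  have := Int.le_of_dvd (by norm_num)
    ((dvd_neg.2 h).trans (dvd_of_eq (by ring : -(k - 1 - (k + 1)) = 2)))
  omega

lemma vert_ne_center (i : ι) (k : ℤ) : P.vert i k ≠ P.center i := by
  simp [vert, P.radius_ne_zero i]

lemma vert_add_one_sub_center (i : ι) (k : ℤ) : P.vert i (k + 1) - P.center i =
    (P.vert i k - P.center i) * Complex.exp (2 * Real.pi * Complex.I / P.sides i) := by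
  unfold vert
  rw [add_sub_cancel_left, add_sub_cancel_left, mul_assoc (P.radius i), ← Complex.exp_add]
  congr 2
  push_cast
  ring

lemma finite_range_vert (i : ι) : (Set.range (P.vert i)).Finite := by
  refine ((Set.finite_Ico (0 : ℤ) (P.sides i)).image (P.vert i)).subset ?_
  rintro _ ⟨k, rfl⟩
  have hp : (0 : ℤ) < P.sides i := by exact_mod_cast P.sides_pos i
  refine ⟨k % P.sides i, ⟨Int.emod_nonneg _ hp.ne', Int.emod_lt_of_pos _ hp⟩, ?_⟩
  rw [P.vert_eq_vert_iff]
  exact (Int.mod_modEq k _).symm.dvd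

lemma convex_tile (i : ι) : Convex ℝ (P.tile i) := convex_convexHull ℝ _

lemma isCompact_tile (i : ι) : IsCompact (P.tile i) := (P.finite_range_vert i).isCompact_convexHull ℝ

lemma vert_mem_tile (i : ι) (k : ℤ) : P.vert i k ∈ P.tile i :=
  subset_convexHull ℝ _ ⟨k, rfl⟩

lemma center_mem_tile (i : ι) : P.center i ∈ P.tile i := by
  have h0 := P.sides_ne_zero i
  have hp := P.sides_pos i
  have hsum : ∑ k ∈ Finset.range (P.sides i), (1 / (P.sides i : ℝ)) • P.vert i (k : ℤ)
      = P.center i := by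
    have hprim := Complex.isPrimitiveRoot_exp (P.sides i) hp.ne'
    have hg := hprim.geom_sum_eq_zero (lt_of_lt_of_le (by norm_num) (P.three_le_sides i))
    have hv : ∀ k : ℕ, P.vert i (k : ℤ) = P.center i +
        P.radius i * Complex.exp (2 * Real.pi * Complex.I / P.sides i) ^ k := by
      intro k
      unfold vert
      rw [← Complex.exp_nat_mul]
      congr 3
      push_cast
      ring
    rw [← Finset.smul_sum]
    simp_rw [hv]
    rw [Finset.sum_add_distrib, ← Finset.mul_sum, hg, mul_zero, add_zero, Finset.sum_const,
      Finset.card_range, nsmul_eq_mul, Complex.real_smul]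
    push_cast
    field_simp
  rw [← hsum]
  refine (P.convex_tile i).sum_mem (fun _ _ => by positivity) ?_ (fun k _ => P.vert_mem_tile i k)
  rw [Finset.sum_const, Finset.card_range, nsmul_eq_mul]
  have : (P.sides i : ℝ) ≠ 0 := by exact_mod_cast hp.ne'
  field_simp

/-- The centre lies on the perpendicular bisector of each side, off the side itself; the sign of
`t` tells on which side of the line `ab` the polygon lies. -/
lemma exists_center_eq_of_mem_edges {i : ι} {a b : ℂ} (h : s(a, b) ∈ P.edges i) :
    ∃ t : ℝ, t ≠ 0 ∧ P.center i = (a + b) / 2 + t * Complex.I * (b - a) := by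
  suffices H : ∀ k : ℤ, ∃ t : ℝ, t ≠ 0 ∧ P.center i = (P.vert i k + P.vert i (k + 1)) / 2 +
      t * Complex.I * (P.vert i (k + 1) - P.vert i k) by
    obtain ⟨k, hk⟩ := h
    obtain ⟨t, ht, hc⟩ := H k
    rcases Sym2.eq_iff.1 hk with ⟨rfl, rfl⟩ | ⟨rfl, rfl⟩
    · exact ⟨t, ht, hc⟩
    · refine ⟨-t, neg_ne_zero.2 ht, ?_⟩
      rw [hc]; push_cast; ring
  intro k
  set x : ℝ := Real.pi / P.sides i with hx
  have hp3 : (3 : ℝ) ≤ P.sides i := by exact_mod_cast P.three_le_sides i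
  have hpi := Real.pi_pos
  have hx0 : 0 < x := by positivity
  have hx2 : x < Real.pi / 2 := by
    rw [hx]; exact div_lt_div_of_pos_left hpi (by norm_num) (by linarith)
  have hs : 0 < Real.sin x := Real.sin_pos_of_pos_of_lt_pi hx0 (by linarith)
  have hc : 0 < Real.cos x := Real.cos_pos_of_mem_Ioo ⟨by linarith, hx2⟩
  refine ⟨Real.cos x / (2 * Real.sin x), by positivity, ?_⟩
  have hω : Complex.exp (2 * Real.pi * Complex.I / P.sides i) =
      (Real.cos x + Real.sin x * Complex.I) ^ 2 := by
    rw [Complex.ofReal_cos, Complex.ofReal_sin, ← Complex.exp_mul_I, ← Complex.exp_nat_mul]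
    congr 1
    rw [hx]; push_cast; ring
  have hs' : (Real.sin x : ℂ) ≠ 0 := by exact_mod_cast hs.ne'
  have hsc : (Real.sin x : ℂ) ^ 2 + (Real.cos x : ℂ) ^ 2 = 1 := by
    exact_mod_cast Real.sin_sq_add_cos_sq x
  have hstep := P.vert_add_one_sub_center i k
  rw [hω] at hstep
  have hb : P.vert i (k + 1) = P.center i + (P.vert i k - P.center i) *
      (Real.cos x + Real.sin x * Complex.I) ^ 2 := by rw [← hstep]; ring
  rw [hb, Complex.ofReal_div, Complex.ofReal_mul, Complex.ofReal_ofNat]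
  generalize P.vert i k = a at *
  generalize P.center i = c at *
  generalize (Real.sin x : ℂ) = s at *
  generalize (Real.cos x : ℂ) = C at *
  have hI : Complex.I ^ 2 = -1 := Complex.I_sq
  have key : s * (1 + (C + s * Complex.I) ^ 2) +
      C * Complex.I * ((C + s * Complex.I) ^ 2 - 1) = 0 := by
    linear_combination (-(s - C * Complex.I)) * hsc +
      (s ^ 3 + 2 * s * C ^ 2 + C * Complex.I * s ^ 2) * hI
  field_simp
  linear_combination (-(a - c)) * key

lemma center_notMem_segment {i : ι} {a b : ℂ} (h : s(a, b) ∈ P.edges i) :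
    P.center i ∉ segment ℝ a b := by
  obtain ⟨t, ht, hc⟩ := P.exists_center_eq_of_mem_edges h
  rintro hseg
  rw [segment_eq_image] at hseg
  obtain ⟨s, -, hs⟩ := hseg
  have hab : b - a ≠ 0 := by
    obtain ⟨k, hk⟩ := h
    intro h0
    obtain rfl : b = a := sub_eq_zero.1 h0
    rcases Sym2.eq_iff.1 hk with ⟨h1, h2⟩ | ⟨h1, h2⟩ <;>
      exact P.vert_ne_vert_add_one i k (h1.trans h2.symm)
  simp only [Complex.real_smul] at hs
  have h1 : ((s - 1 / 2 : ℝ) : ℂ) = t * Complex.I := by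
    apply mul_right_cancel₀ hab
    push_cast at hs ⊢
    linear_combination hs + hc
  have := congrArg Complex.im h1
  simp at this
  exact ht this.symm

lemma segment_subset_tile {i : ι} {a b : ℂ} (h : s(a, b) ∈ P.edges i) :
    segment ℝ a b ⊆ P.tile i := by
  obtain ⟨k, hk⟩ := h
  rcases Sym2.eq_iff.1 hk with ⟨rfl, rfl⟩ | ⟨rfl, rfl⟩ <;>
    exact (P.convex_tile i).segment_subset (P.vert_mem_tile i _) (P.vert_mem_tile i _)

end RegularPolygons

/-! ### Angles seen from a point outside a convex set -/

/-- On a closed convex set that misses `c`, the angle at `c` between two points is the difference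
of a single-valued argument function. -/
lemma exists_arg_div_eq_sub {K : Set ℂ} (hK : Convex ℝ K) (hcl : IsClosed K) {c : ℂ} (hc : c ∉ K) :
    ∃ θ : ℂ → ℝ, ∀ u ∈ K, ∀ v ∈ K, Complex.arg ((v - c) / (u - c)) = θ v - θ u := by
  obtain ⟨g, s, hgc, hgK⟩ := geometric_hahn_banach_point_closed hK hcl hc
  set β : ℂ := ⟨g 1, -g Complex.I⟩ with hβ
  have hg : ∀ z : ℂ, (β * z).re = g z := by
    intro z
    have hz : z = z.re • (1 : ℂ) + z.im • Complex.I := by simp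
    conv_rhs => rw [hz, map_add, map_smul, map_smul]
    simp [hβ]
    ring
  have hpos : ∀ v ∈ K, 0 < (β * (v - c)).re := by
    intro v hv
    rw [hg, map_sub]
    linarith [hgK v hv]
  refine ⟨fun v => Complex.arg (β * (v - c)), fun u hu v hv => ?_⟩
  have hu' := hpos u hu
  have hv' := hpos v hv
  have h0 : ∀ z : ℂ, 0 < z.re → z ≠ 0 := by rintro z hz rfl; simp at hz
  have hβ0 : β ≠ 0 := left_ne_zero_of_mul (h0 _ hu')
  have hau := abs_lt.1 (Complex.abs_arg_lt_pi_div_two_iff.2 (Or.inl hu'))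
  have hav := abs_lt.1 (Complex.abs_arg_lt_pi_div_two_iff.2 (Or.inl hv'))
  have hq : (v - c) / (u - c) = (β * (v - c)) * (β * (u - c))⁻¹ := by
    rw [← div_eq_mul_inv, mul_div_mul_left _ _ hβ0]
  have hinv : Complex.arg (β * (u - c))⁻¹ = -Complex.arg (β * (u - c)) := by
    rw [Complex.arg_inv, if_neg]
    intro h
    rw [h] at hau
    linarith [Real.pi_pos]
  rw [hq, Complex.arg_mul (h0 _ hv') (inv_ne_zero (h0 _ hu')), hinv]
  · ring
  · rw [hinv]
    constructor <;> linarith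

/-! ### Flags of a tiling and their adjacency -/

namespace RegularPolygonTiling

variable {ι : Type*} (T : RegularPolygonTiling ι)

lemma center_notMem_tile {i j : ι} (hij : i ≠ j) : T.center i ∉ T.tile j := by
  intro h
  have hmem : T.center i ∈ T.tile i ∩ T.tile j := ⟨T.center_mem_tile i, h⟩
  rcases T.edge_to_edge hij with h0 | ⟨v, ⟨k, rfl⟩, -, hv⟩ | ⟨v, w, he, -, hvw⟩
  · rw [h0] at hmem
    exact hmem
  · rw [hv] at hmem
    exact T.vert_ne_center i k hmem.symm
  · rw [hvw] at hmem
    exact T.center_notMem_segment he hmem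

lemma exists_common_vertex {i j : ι} (h : (T.tile i ∩ T.tile j).Nonempty) :
    ∃ v, v ∈ Set.range (T.vert i) ∧ v ∈ Set.range (T.vert j) := by
  by_cases hij : i = j
  · subst hij
    exact ⟨T.vert i 0, ⟨0, rfl⟩, ⟨0, rfl⟩⟩
  rcases T.edge_to_edge hij with h0 | ⟨v, hi, hj, -⟩ | ⟨v, w, ⟨k, hk⟩, ⟨l, hl⟩, -⟩
  · rw [h0] at h
    exact absurd h Set.not_nonempty_empty
  · exact ⟨v, hi, hj⟩
  · refine ⟨v, ?_, ?_⟩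
    · rcases Sym2.eq_iff.1 hk with ⟨h, -⟩ | ⟨-, h⟩ <;> exact ⟨_, h⟩
    · rcases Sym2.eq_iff.1 hl with ⟨h, -⟩ | ⟨-, h⟩ <;> exact ⟨_, h⟩

/-- Two tiles on the same side of a common edge coincide: otherwise the centre nearer to the edge
would lie in both. -/
lemma eq_of_same_side {i j : ι} {a b : ℂ} (hj : s(a, b) ∈ T.edges j) {t s : ℝ}
    (hti : T.center i = (a + b) / 2 + t * Complex.I * (b - a))
    (htj : T.center j = (a + b) / 2 + s * Complex.I * (b - a))
    (h0 : 0 ≤ t / s) (h1 : t / s ≤ 1) (hs : s ≠ 0) : i = j := by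
  by_contra hij
  refine T.center_notMem_tile hij ?_
  have hmid : (a + b) / 2 ∈ T.tile j := by
    refine T.segment_subset_tile hj ?_
    rw [segment_eq_image]
    refine ⟨1 / 2, by norm_num, ?_⟩
    simp only [Complex.real_smul]
    push_cast
    ring
  have hseg := (T.convex_tile j).segment_subset hmid (T.center_mem_tile j)
  refine hseg ?_
  rw [segment_eq_image]
  refine ⟨t / s, ⟨h0, h1⟩, ?_⟩
  have hs' : (s : ℂ) ≠ 0 := by exact_mod_cast hs
  simp only [Complex.real_smul]
  rw [hti, htj]
  push_cast
  field_simp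
  ring

/-- An edge belongs to at most two tiles, one on each side. -/
lemma eq_or_eq_or_eq_of_mem_edges {i j k : ι} {e : Sym2 ℂ} (hi : e ∈ T.edges i)
    (hj : e ∈ T.edges j) (hk : e ∈ T.edges k) : i = j ∨ j = k ∨ i = k := by
  induction e with
  | _ a b =>
  obtain ⟨t, ht, hti⟩ := T.exists_center_eq_of_mem_edges hi
  obtain ⟨s, hs, htj⟩ := T.exists_center_eq_of_mem_edges hj
  obtain ⟨r, hr, htk⟩ := T.exists_center_eq_of_mem_edges hk
  have key : ∀ {i j : ι} {t s : ℝ}, s(a, b) ∈ T.edges i → s(a, b) ∈ T.edges j →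
      T.center i = (a + b) / 2 + t * Complex.I * (b - a) →
      T.center j = (a + b) / 2 + s * Complex.I * (b - a) → 0 < t * s → i = j := by
    intro i j t s hi hj hti htj hts
    have ht : t ≠ 0 := left_ne_zero_of_mul hts.ne'
    have hs : s ≠ 0 := right_ne_zero_of_mul hts.ne'
    have h0 : 0 < t / s := by
      rw [show t / s = t * s / s ^ 2 by field_simp]
      positivity
    rcases le_total (t / s) 1 with h | h
    · exact T.eq_of_same_side hj hti htj h0.le h hs
    · refine (T.eq_of_same_side hi htj hti ?_ ?_ ht).symm
      · rw [← inv_div]; positivity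
      · rw [← inv_div]; exact inv_le_one_of_one_le₀ h
  by_cases h1 : 0 < t * s
  · exact Or.inl (key hi hj hti htj h1)
  by_cases h2 : 0 < s * r
  · exact Or.inr (Or.inl (key hj hk htj htk h2))
  refine Or.inr (Or.inr (key hi hk hti htk ?_))
  -- `(t * s) * (s * r) = s ^ 2 * (t * r)` is positive
  have h3 : 0 < (t * s) * (s * r) :=
    mul_pos_of_neg_of_neg (lt_of_le_of_ne (not_lt.1 h1) (mul_ne_zero ht hs))
      (lt_of_le_of_ne (not_lt.1 h2) (mul_ne_zero hs hr))
  have h4 : 0 < s ^ 2 * (t * r) := by linarith [h3, (by ring : t * s * (s * r) = s ^ 2 * (t * r))]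
  exact (pos_iff_pos_of_mul_pos h4).1 (by positivity)

variable {T}

lemma Flag.edge_ne_diag (Ψ : T.Flag) {a b : ℂ} (h : Ψ.edge = s(a, b)) : a ≠ b := by
  rintro rfl
  obtain ⟨k, hk⟩ := Ψ.edge_mem
  rw [h] at hk
  rcases Sym2.eq_iff.1 hk with ⟨h1, h2⟩ | ⟨h1, h2⟩ <;>
    exact T.vert_ne_vert_add_one _ k (h1.trans h2.symm)

variable (T)

lemma edge_mem_edges (i : ι) (k : ℤ) (ε : ℤˣ) :
    s(T.vert i k, T.vert i (k + ε)) ∈ T.edges i := by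
  rcases Int.units_eq_one_or ε with rfl | rfl
  · exact ⟨k, by simp⟩
  · refine ⟨k - 1, ?_⟩
    rw [Sym2.eq_swap]
    simp [sub_eq_add_neg]

/-- The flag of the tile `i` at its `k`-th vertex, whose edge leads to the next (`ε = 1`) or to the
previous (`ε = -1`) vertex. -/
def flagAt (i : ι) (k : ℤ) (ε : ℤˣ) : T.Flag where
  vertex := T.vert i k
  edge := s(T.vert i k, T.vert i (k + ε))
  face := i
  vertex_mem := Sym2.mem_mk_left _ _
  edge_mem := T.edge_mem_edges i k ε

lemma exists_eq_flagAt (Ψ : T.Flag) : ∃ k ε, Ψ = T.flagAt Ψ.face k ε := by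
  obtain ⟨k, hk⟩ := Ψ.edge_mem
  have hv := Ψ.vertex_mem
  rw [← hk, Sym2.mem_iff] at hv
  rcases hv with hv | hv
  · exact ⟨k, 1, Flag.ext hv (by simp [flagAt, ← hk]) rfl⟩
  · refine ⟨k + 1, -1, Flag.ext hv ?_ rfl⟩
    simp [flagAt, ← hk, Sym2.eq_swap]

lemma flagAt_congr {i : ι} {k l : ℤ} (h : T.vert i k = T.vert i l) (ε : ℤˣ) :
    T.flagAt i k ε = T.flagAt i l ε := by
  have h' : T.vert i (k + ε) = T.vert i (l + ε) := by
    rw [T.vert_eq_vert_iff] at h ⊢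
    simpa using h
  exact Flag.ext h (by simp [flagAt, h, h']) rfl

lemma flagAt_add_mul_sides (i : ι) (k n : ℤ) (ε : ℤˣ) :
    T.flagAt i (k + T.sides i * n) ε = T.flagAt i k ε :=
  T.flagAt_congr (T.vert_add_mul_sides i k n) ε

lemma edge_flagAt_neg_ne (i : ι) (k : ℤ) (ε : ℤˣ) :
    (T.flagAt i k (-ε)).edge ≠ (T.flagAt i k ε).edge := by
  intro h
  have h' : T.vert i (k + (-ε : ℤˣ)) = T.vert i (k + ε) := Sym2.congr_right.1 h
  rcases Int.units_eq_one_or ε with rfl | rfl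
  · exact T.vert_sub_one_ne_vert_add_one i k (by simpa [sub_eq_add_neg] using h')
  · exact T.vert_sub_one_ne_vert_add_one i k (by simpa [sub_eq_add_neg] using h'.symm)

/-- At a vertex of a tile there are only two flags of that tile. -/
lemma eq_flagAt_or_eq_flagAt_neg {Ψ : T.Flag} {i : ι} {k : ℤ} (hf : Ψ.face = i)
    (hv : Ψ.vertex = T.vert i k) (ε : ℤˣ) :
    Ψ = T.flagAt i k ε ∨ Ψ = T.flagAt i k (-ε) := by
  obtain ⟨l, δ, h⟩ := T.exists_eq_flagAt Ψ
  rw [hf] at h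
  have hl : T.vert i l = T.vert i k := by rw [← hv, h]; rfl
  rw [T.flagAt_congr hl] at h
  have : δ = ε ∨ δ = -ε := by
    rcases Int.units_eq_one_or ε with rfl | rfl <;> rcases Int.units_eq_one_or δ with rfl | rfl <;>
      simp
  rcases this with rfl | rfl
  · exact Or.inl h
  · exact Or.inr h

lemma adjacent_zero_flagAt (i : ι) (k : ℤ) (ε : ℤˣ) :
    T.Adjacent 0 (T.flagAt i k ε) (T.flagAt i (k + ε) (-ε)) := by
  have he : (T.flagAt i (k + ε) (-ε)).edge = (T.flagAt i k ε).edge := by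
    simp only [flagAt]
    rw [Sym2.eq_swap]
    simp
  refine ⟨?_, by simpa using he, by simp [flagAt]⟩
  have := (T.flagAt i k ε).edge_ne_diag rfl
  simpa [flagAt] using this.symm

lemma adjacent_one_flagAt (i : ι) (k : ℤ) (ε : ℤˣ) :
    T.Adjacent 1 (T.flagAt i k ε) (T.flagAt i k (-ε)) :=
  ⟨by simp [flagAt], by simpa using T.edge_flagAt_neg_ne i k ε, by simp [flagAt]⟩

variable {T}

lemma Adjacent.symm {i : Fin 3} {Ψ Ψ' : T.Flag} (h : T.Adjacent i Ψ Ψ') : T.Adjacent i Ψ' Ψ :=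
  ⟨by rw [eq_comm]; exact h.1, by rw [eq_comm]; exact h.2.1, by rw [eq_comm]; exact h.2.2⟩

/-- The `i`-adjacent flag is unique. -/
lemma Adjacent.unique {i : Fin 3} {Ψ Ψ₁ Ψ₂ : T.Flag} (h₁ : T.Adjacent i Ψ Ψ₁)
    (h₂ : T.Adjacent i Ψ Ψ₂) : Ψ₁ = Ψ₂ := by
  obtain ⟨v₁, e₁, f₁⟩ := h₁
  obtain ⟨v₂, e₂, f₂⟩ := h₂
  fin_cases i
  · simp at v₁ e₁ f₁ v₂ e₂ f₂
    refine Flag.ext ?_ (e₁.trans e₂.symm) (f₁.trans f₂.symm)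
    obtain ⟨b, hb⟩ := Ψ.vertex_mem
    have h₁ := Ψ₁.vertex_mem
    have h₂ := Ψ₂.vertex_mem
    rw [e₁, hb, Sym2.mem_iff] at h₁
    rw [e₂, hb, Sym2.mem_iff] at h₂
    rw [h₁.resolve_left v₁, h₂.resolve_left v₂]
  · simp at v₁ e₁ f₁ v₂ e₂ f₂
    obtain ⟨k, ε, hΨ⟩ := T.exists_eq_flagAt Ψ
    have hv : Ψ.vertex = T.vert Ψ.face k := by rw [hΨ]; rfl
    have key : ∀ Ψ' : T.Flag, Ψ'.vertex = Ψ.vertex → Ψ'.edge ≠ Ψ.edge → Ψ'.face = Ψ.face →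
        Ψ' = T.flagAt Ψ.face k (-ε) := by
      intro Ψ' v e f
      refine (T.eq_flagAt_or_eq_flagAt_neg f (v.trans hv) ε).resolve_left fun h => e ?_
      rw [h, ← hΨ]
    rw [key _ v₁ e₁ f₁, key _ v₂ e₂ f₂]
  · simp at v₁ e₁ f₁ v₂ e₂ f₂
    refine Flag.ext (v₁.trans v₂.symm) (e₁.trans e₂.symm) ?_
    have h := T.eq_or_eq_or_eq_of_mem_edges Ψ.edge_mem (e₁ ▸ Ψ₁.edge_mem) (e₂ ▸ Ψ₂.edge_mem)
    rcases h with h | h | h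
    · exact absurd h.symm f₁
    · exact h
    · exact absurd h.symm f₂

end RegularPolygonTiling

/-! ### Cyclic rotation -/

lemma val_finRotate_pow {n : ℕ} (k : ℕ) (j : Fin (n + 1)) :
    ((finRotate (n + 1) ^ k) j).val = (j.val + k) % (n + 1) := by
  induction k with
  | zero => simp [Nat.mod_eq_of_lt j.isLt]
  | succ k ih =>
    rw [pow_succ', Equiv.Perm.mul_apply, finRotate_apply, Fin.val_add, ih, Fin.val_one',
      ← Nat.add_mod, add_assoc]

lemma exists_finRotate_pow_apply_eq {n : ℕ} (j j' : Fin n) :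
    ∃ k : ℕ, (finRotate n ^ k) j = j' := by
  cases n with
  | zero => exact j.elim0
  | succ n =>
    refine ⟨n + 1 - j.val + j'.val, Fin.ext ?_⟩
    have hj := j.isLt
    rw [val_finRotate_pow, show j.val + (n + 1 - j.val + j'.val) = j'.val + (n + 1) by omega,
      Nat.add_mod_right, Nat.mod_eq_of_lt j'.isLt]

lemma finRotate_pow_self (n : ℕ) : finRotate n ^ n = 1 := by
  cases n with
  | zero => rfl
  | succ n =>
    ext j
    rw [val_finRotate_pow, Nat.add_mod_right, Nat.mod_eq_of_lt j.isLt]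
    rfl

/-! ### The flags at a vertex -/

namespace RegularPolygonTiling

variable {ι : Type*} {T : RegularPolygonTiling ι}

/-- The flags at a vertex of a tiling with an `n`-term vertex symbol, in cyclic order: `A j` and
`B j` are the two flags of the `j`-th tile there, and `B j`, `A (j + 1)` share their edge. -/
lemma HasVertexSymbol.exists_flags_at {p : List ℕ} (hT : T.HasVertexSymbol p)
    (hp : 3 ≤ p.length) {v : ℂ} (hv : v ∈ T.vertices) :
    ∃ A B : Fin p.length → T.Flag,
      (∀ j, T.Adjacent 1 (A j) (B j)) ∧ (∀ j, T.Adjacent 2 (B j) (A (finRotate p.length j))) ∧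
      ∀ Ψ : T.Flag, Ψ.vertex = v ↔ ∃ j, Ψ = A j ∨ Ψ = B j := by
  obtain ⟨f, hinj, hrange, -, hedge⟩ := hT v hv
  choose e hve hef hef' using hedge
  set r := finRotate p.length with hr
  have hr1 : ∀ j, r j ≠ j := by
    intro j
    obtain ⟨n, hn⟩ : ∃ n, p.length = n + 1 + 1 := ⟨p.length - 2, by omega⟩
    have hs := support_finRotate (n := n)
    rw [← hn] at hs
    exact Equiv.Perm.mem_support.1 (hs ▸ Finset.mem_univ j)
  have hr2 : ∀ j, r (r j) ≠ j := by
    intro j h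
    have hk : ∀ k : ℕ, (r ^ k) j = j ∨ (r ^ k) j = r j := by
      intro k
      induction k with
      | zero => simp
      | succ k ih =>
        rw [pow_succ', Equiv.Perm.mul_apply]
        rcases ih with ih | ih <;> simp [ih, h]
    have hcard : Fintype.card (Fin p.length) ≤ 2 := by
      rw [← Finset.card_univ]
      refine (Finset.card_le_card (t := {j, r j}) ?_).trans Finset.card_le_two
      intro j' _
      obtain ⟨k, rfl⟩ := exists_finRotate_pow_apply_eq j j'
      simpa using hk k
    rw [Fintype.card_fin] at hcard
    omega
  -- otherwise three different tiles would share an edge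
  have hne : ∀ j, e j ≠ e (r j) := by
    intro j h
    have h2 : e j ∈ T.edges (f (r (r j))) := h ▸ hef' (r j)
    rcases T.eq_or_eq_or_eq_of_mem_edges (hef j) (hef' j) h2 with h | h | h
    · exact hr1 j (hinj h).symm
    · exact hr1 (r j) (hinj h).symm
    · exact hr2 j (hinj h).symm
  have hefs : ∀ j, e (r.symm j) ∈ T.edges (f j) := fun j => by
    simpa using hef' (r.symm j)
  let A : Fin p.length → T.Flag := fun j => ⟨v, e (r.symm j), f j, hve _, hefs j⟩
  let B : Fin p.length → T.Flag := fun j => ⟨v, e j, f j, hve _, hef j⟩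
  have hAB : ∀ j, T.Adjacent 1 (A j) (B j) := fun j =>
    ⟨by simp [A, B], by simpa [A, B] using (hne (r.symm j)).symm, by simp [A, B]⟩
  refine ⟨A, B, hAB, fun j => ⟨by simp [A, B], by simp [A, B], ?_⟩, fun Ψ => ⟨?_, ?_⟩⟩
  · simpa [A, B] using fun h => hr1 j (hinj h)
  · intro hΨ
    have hmem : Ψ.face ∈ {i | v ∈ Set.range (T.vert i)} := by
      obtain ⟨k, ε, h⟩ := T.exists_eq_flagAt Ψ
      refine ⟨k, ?_⟩
      rw [← hΨ, h]; rfl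
    rw [← hrange] at hmem
    obtain ⟨j, hj⟩ := hmem
    refine ⟨j, ?_⟩
    by_cases he : Ψ.edge = (A j).edge
    · exact Or.inl (Flag.ext hΨ he hj.symm)
    · refine Or.inr (Adjacent.unique (i := 1) (Ψ := A j) ⟨?_, ?_, ?_⟩ (hAB j))
      · simpa using hΨ
      · simpa using he
      · simpa using hj.symm
  · rintro ⟨j, rfl | rfl⟩ <;> rfl

lemma Flag.vertex_mem_vertices (Ψ : T.Flag) : Ψ.vertex ∈ T.vertices := by
  obtain ⟨k, ε, h⟩ := T.exists_eq_flagAt Ψ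
  refine ⟨Ψ.face, k, ?_⟩
  conv_rhs => rw [h]
  rfl

lemma HasVertexSymbol.exists_adjacent {p : List ℕ} (hT : T.HasVertexSymbol p)
    (hp : 3 ≤ p.length) (i : Fin 3) (Ψ : T.Flag) : ∃ Ψ', T.Adjacent i Ψ Ψ' := by
  fin_cases i
  · obtain ⟨k, ε, h⟩ := T.exists_eq_flagAt Ψ
    rw [h]
    exact ⟨_, T.adjacent_zero_flagAt _ k ε⟩
  · obtain ⟨k, ε, h⟩ := T.exists_eq_flagAt Ψ
    rw [h]
    exact ⟨_, T.adjacent_one_flagAt _ k ε⟩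
  · obtain ⟨A, B, -, hBA, h⟩ := hT.exists_flags_at hp Ψ.vertex_mem_vertices
    obtain ⟨j, hj | hj⟩ := (h Ψ).1 rfl
    · rw [hj]
      refine ⟨B ((finRotate p.length).symm j), Adjacent.symm ?_⟩
      have := hBA ((finRotate p.length).symm j)
      rwa [Equiv.apply_symm_apply] at this
    · rw [hj]
      exact ⟨_, hBA j⟩

/-- The permutations that send each flag to its `i`-adjacent flag. -/
lemma HasVertexSymbol.exists_perm {p : List ℕ} (hT : T.HasVertexSymbol p) (hp : 3 ≤ p.length) :
    ∃ σ : Fin 3 → Equiv.Perm T.Flag, ∀ i Ψ Ψ', T.Adjacent i Ψ Ψ' ↔ σ i Ψ = Ψ' := by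
  choose s hs using hT.exists_adjacent hp
  have hinv : ∀ i, Function.Involutive (s i) := fun i Ψ =>
    (hs i (s i Ψ)).unique (hs i Ψ).symm
  refine ⟨fun i => (hinv i).toPerm, fun i Ψ Ψ' => ⟨fun h => (hs i Ψ).unique h, ?_⟩⟩
  rintro rfl
  exact hs i Ψ

end RegularPolygonTiling

/-! ### Skew actions of the Coxeter group -/

namespace RegularPolygonTiling

variable {ι : Type*} {T : RegularPolygonTiling ι} {A : Type*} [AddCommGroup A]

/-- The permutation of `T.Flag × A` that lies over the permutation `s` of the flags and adds to the
second component the increment `d u v`, where `u` and `v` are the old and the new vertex. -/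
def skewPerm (d : ℂ → ℂ → A) (s : Equiv.Perm T.Flag) : Equiv.Perm (T.Flag × A) where
  toFun x := (s x.1, x.2 + d x.1.vertex (s x.1).vertex)
  invFun x := (s.symm x.1, x.2 - d (s.symm x.1).vertex x.1.vertex)
  left_inv x := by simp
  right_inv x := by simp

lemma skewPerm_apply (d : ℂ → ℂ → A) (s : Equiv.Perm T.Flag) (Ψ : T.Flag) (t : A) :
    skewPerm d s (Ψ, t) = (s Ψ, t + d Ψ.vertex (s Ψ).vertex) := rfl

variable (T) in
/-- The increments `d u v` along the sides of each tile are the differences of a function `h` on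
the cyclically indexed vertices, which has period `m`. -/
structure IsPeriodicCocycle (m : ℕ) (d : ℂ → ℂ → A) : Prop where
  self : ∀ v, d v v = 0
  tile : ∀ i, ∃ h : ℤ → A,
    (∀ (k : ℤ) (ε : ℤˣ), d (T.vert i k) (T.vert i (k + ε)) = h (k + ε) - h k) ∧
    ∀ (k : ℤ) (ε : ℤˣ), h (k + m * ε) = h k

section

variable {σ : Fin 3 → Equiv.Perm T.Flag} (hσ : ∀ i Ψ Ψ', T.Adjacent i Ψ Ψ' ↔ σ i Ψ = Ψ')
include hσ

lemma vertex_perm {i : Fin 3} (hi : i ≠ 0) (Ψ : T.Flag) : (σ i Ψ).vertex = Ψ.vertex :=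
  ((hσ i Ψ _).2 rfl).1.2 hi

lemma perm_zero_flagAt (i : ι) (k : ℤ) (ε : ℤˣ) :
    σ 0 (T.flagAt i k ε) = T.flagAt i (k + ε) (-ε) :=
  (hσ _ _ _).1 (T.adjacent_zero_flagAt i k ε)

lemma perm_one_flagAt (i : ι) (k : ℤ) (ε : ℤˣ) :
    σ 1 (T.flagAt i k ε) = T.flagAt i k (-ε) :=
  (hσ _ _ _).1 (T.adjacent_one_flagAt i k ε)

lemma perm_perm (i : Fin 3) (Ψ : T.Flag) : σ i (σ i Ψ) = Ψ :=
  (hσ _ _ _).1 ((hσ _ _ _).2 rfl).symm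

lemma perm_zero_perm_two (Ψ : T.Flag) : σ 0 (σ 2 Ψ) = σ 2 (σ 0 Ψ) := by
  have h0 := (hσ 0 Ψ _).2 rfl
  have h2 := (hσ 2 Ψ _).2 rfl
  have h02 := (hσ 2 (σ 0 Ψ) _).2 rfl
  obtain ⟨v0, e0, f0⟩ := h0
  obtain ⟨v2, e2, f2⟩ := h2
  obtain ⟨v02, e02, f02⟩ := h02
  simp at v0 e0 f0 v2 e2 f2 v02 e02 f02
  refine (hσ 0 _ _).1 ⟨?_, ?_, ?_⟩
  · simpa [v02, v2] using v0
  · simp [e02, e0, e2]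
  · -- both faces are the tile on the other side of the edge of `Ψ`
    simp only [ne_eq, Fin.reduceEq, not_false_eq_true, iff_true]
    have h := T.eq_or_eq_or_eq_of_mem_edges Ψ.edge_mem
      (e2 ▸ (σ 2 Ψ).edge_mem) ((e02.trans e0) ▸ (σ 2 (σ 0 Ψ)).edge_mem)
    rcases h with h | h | h
    · exact absurd h.symm f2
    · exact h.symm
    · exact absurd (h.symm.trans f0.symm) f02

variable {m : ℕ} {d : ℂ → ℂ → A} (hd : T.IsPeriodicCocycle m d)
include hd

lemma skewPerm_apply_of_ne {i : Fin 3} (hi : i ≠ 0) (Ψ : T.Flag) (t : A) :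
    skewPerm d (σ i) (Ψ, t) = (σ i Ψ, t) := by
  rw [skewPerm_apply, vertex_perm hσ hi, hd.self, add_zero]

lemma skewPerm_sq (i : Fin 3) : skewPerm d (σ i) ^ 2 = 1 := by
  ext1 ⟨Ψ, t⟩
  rw [sq, Equiv.Perm.mul_apply, Equiv.Perm.one_apply]
  by_cases hi : i = 0
  · subst hi
    obtain ⟨k, ε, h⟩ := T.exists_eq_flagAt Ψ
    obtain ⟨g, hg, -⟩ := hd.tile Ψ.face
    have h1 := hg k ε
    have h2 := hg (k + ε) (-ε)
    rw [skewPerm_apply, skewPerm_apply, perm_perm hσ]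
    refine Prod.ext rfl ?_
    rw [h, perm_zero_flagAt hσ]
    simp only [flagAt]
    rw [h1]
    simp only [Units.val_neg, add_neg_cancel_right] at h2
    rw [h2]
    abel
  · rw [skewPerm_apply_of_ne hσ hd hi, skewPerm_apply_of_ne hσ hd hi, perm_perm hσ]

lemma skewPerm_zero_two : (skewPerm d (σ 2) * skewPerm d (σ 0)) ^ 2 = 1 := by
  have hcomm : Commute (skewPerm d (σ 2)) (skewPerm d (σ 0)) := by
    ext1 ⟨Ψ, t⟩
    rw [Equiv.Perm.mul_apply, Equiv.Perm.mul_apply, skewPerm_apply d (σ 0) Ψ,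
      skewPerm_apply_of_ne hσ hd (i := 2) (by decide),
      skewPerm_apply_of_ne hσ hd (i := 2) (by decide), skewPerm_apply, perm_zero_perm_two hσ,
      vertex_perm hσ (i := 2) (by decide), vertex_perm hσ (i := 2) (by decide)]
  rw [hcomm.mul_pow, skewPerm_sq hσ hd, skewPerm_sq hσ hd, one_mul]

/-- Walking along `q` sides of a tile. -/
lemma skewPerm_zero_one_pow {i : ι} {h : ℤ → A}
    (hh : ∀ (k : ℤ) (ε : ℤˣ), d (T.vert i k) (T.vert i (k + ε)) = h (k + ε) - h k)
    (k : ℤ) (ε : ℤˣ) (t : A) (q : ℕ) :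
    ((skewPerm d (σ 1) * skewPerm d (σ 0)) ^ q) (T.flagAt i k ε, t) =
      (T.flagAt i (k + q * ε) ε, t + (h (k + q * ε) - h k)) := by
  induction q with
  | zero => simp
  | succ q ih =>
    rw [pow_succ', Equiv.Perm.mul_apply, ih, Equiv.Perm.mul_apply, skewPerm_apply d (σ 0),
      skewPerm_apply_of_ne hσ hd (i := 1) (by decide), perm_zero_flagAt hσ,
      perm_one_flagAt hσ, neg_neg]
    have e : k + ((q + 1 : ℕ) : ℤ) * (ε : ℤ) = k + q * ε + ε := by push_cast; ring
    rw [e]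
    refine Prod.ext rfl ?_
    simp only [flagAt]
    rw [hh]
    abel

lemma skewPerm_zero_one (hm : ∀ i, T.sides i ∣ m) :
    (skewPerm d (σ 1) * skewPerm d (σ 0)) ^ m = 1 := by
  ext1 ⟨Ψ, t⟩
  obtain ⟨k, ε, h⟩ := T.exists_eq_flagAt Ψ
  obtain ⟨g, hg, hper⟩ := hd.tile Ψ.face
  obtain ⟨c, hc⟩ := hm Ψ.face
  rw [h, skewPerm_zero_one_pow hσ hd hg, hper, sub_self, add_zero, hc]
  have e : k + ((T.sides Ψ.face * c : ℕ) : ℤ) * (ε : ℤ) = k + T.sides Ψ.face * (c * ε) := by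
    push_cast; ring
  rw [e, flagAt_add_mul_sides]
  rfl

lemma skewPerm_one_two {p : List ℕ} (hT : T.HasVertexSymbol p) (hp : 3 ≤ p.length) :
    (skewPerm d (σ 2) * skewPerm d (σ 1)) ^ p.length = 1 := by
  ext1 ⟨Ψ, t⟩
  obtain ⟨A, B, hAB, hBA, hΨ⟩ := hT.exists_flags_at hp Ψ.vertex_mem_vertices
  set r := finRotate p.length with hr
  set F := skewPerm d (σ 2) * skewPerm d (σ 1) with hF
  have hFA : ∀ j, F (A j, t) = (A (r j), t) := by
    intro j
    rw [hF, Equiv.Perm.mul_apply, skewPerm_apply_of_ne hσ hd (by decide),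
      skewPerm_apply_of_ne hσ hd (by decide), (hσ _ _ _).1 (hAB j), (hσ _ _ _).1 (hBA j)]
  have hFB : ∀ j, F (B (r j), t) = (B j, t) := by
    intro j
    rw [hF, Equiv.Perm.mul_apply, skewPerm_apply_of_ne hσ hd (by decide),
      skewPerm_apply_of_ne hσ hd (by decide), (hσ _ _ _).1 (hAB (r j)).symm,
      (hσ _ _ _).1 (hBA j).symm]
  have hkA : ∀ (q : ℕ) j, (F ^ q) (A j, t) = (A ((r ^ q) j), t) := by
    intro q j
    induction q with
    | zero => rfl
    | succ q ih => rw [pow_succ', Equiv.Perm.mul_apply, ih, hFA, pow_succ', Equiv.Perm.mul_apply]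
  have hkB : ∀ (q : ℕ) j, (F ^ q) (B ((r ^ q) j), t) = (B j, t) := by
    intro q
    induction q with
    | zero => intro j; rfl
    | succ q ih =>
      intro j
      rw [pow_succ, Equiv.Perm.mul_apply, pow_succ' r, Equiv.Perm.mul_apply r, hFB, ih]
  obtain ⟨j, hj | hj⟩ := (hΨ Ψ).1 rfl
  · rw [hj, hkA, hr, finRotate_pow_self]
    rfl
  · have := hkB p.length j
    rw [hr, finRotate_pow_self, Equiv.Perm.one_apply] at this
    rw [hj, this]
    rfl

/-- The skew permutations satisfy the Coxeter relations, hence define an action. -/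
lemma exists_skewAction {p : List ℕ} (hT : T.HasVertexSymbol p) (hp : 3 ≤ p.length)
    (hm : ∀ i, T.sides i ∣ m) :
    ∃ ψ : CoxeterMN m p.length →* (Equiv.Perm (T.Flag × A))ᵐᵒᵖ,
      ∀ i, ψ (CoxeterMN.rho m p.length i) = MulOpposite.op (skewPerm d (σ i)) := by
  have hrel : ∀ r ∈ coxeterRels m p.length,
      FreeGroup.lift (fun i => MulOpposite.op (skewPerm d (σ i))) r = 1 := by
    rintro r (rfl | rfl | rfl | rfl | rfl | rfl) <;>
      simp only [map_pow, map_mul, FreeGroup.lift_apply_of, ← MulOpposite.op_mul,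
        ← MulOpposite.op_pow, MulOpposite.op_eq_one_iff]
    · exact skewPerm_sq hσ hd 0
    · exact skewPerm_sq hσ hd 1
    · exact skewPerm_sq hσ hd 2
    · exact skewPerm_zero_two hσ hd
    · exact skewPerm_zero_one hσ hd hm
    · exact skewPerm_one_two hσ hd hT hp
  exact ⟨PresentedGroup.toGroup hrel, fun i => PresentedGroup.toGroup.of hrel⟩

end

lemma HasVertexSymbol.sides_dvd {p : List ℕ} (hT : T.HasVertexSymbol p) {m : ℕ}
    (hpm : ∀ q ∈ p, q ∣ m) (i : ι) : T.sides i ∣ m := by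
  obtain ⟨f, -, hrange, hs, -⟩ := hT (T.vert i 0) ⟨i, 0, rfl⟩
  have hi : i ∈ Set.range f := by rw [hrange]; exact ⟨0, rfl⟩
  obtain ⟨j, rfl⟩ := hi
  rw [hs]
  exact hpm _ (List.get_mem _ _)

/-- The flag action: the skew action for trivial increments. -/
lemma HasVertexSymbol.exists_isFlagAction {p : List ℕ} (hT : T.HasVertexSymbol p)
    (hp : 3 ≤ p.length) {m : ℕ} (hpm : ∀ q ∈ p, q ∣ m) :
    ∃ φ : CoxeterMN m p.length →* (Equiv.Perm T.Flag)ᵐᵒᵖ, T.IsFlagAction φ := by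
  obtain ⟨σ, hσ⟩ := hT.exists_perm hp
  have hd : T.IsPeriodicCocycle m (fun _ _ : ℂ => (0 : PUnit.{1})) :=
    ⟨fun _ => rfl, fun _ => ⟨0, fun _ _ => rfl, fun _ _ => rfl⟩⟩
  obtain ⟨ψ, hψ⟩ := exists_skewAction hσ hd hT hp (hT.sides_dvd hpm)
  let e := MulEquiv.op (Equiv.prodPUnit.{0} T.Flag).permCongrHom
  refine ⟨e.toMonoidHom.comp ψ, fun i Ψ => (hσ _ _ _).2 ?_⟩
  simp only [MonoidHom.comp_apply, hψ]
  rfl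

/-! ### Winding around the centre of a tile -/

/-- The increment of the angle around the centre of the tile `f`, modulo `m / p` full turns if `f`
has `p` sides. -/
def angleIncrement (T : RegularPolygonTiling ι) (m : ℕ) (f : ι) (u v : ℂ) :
    AddCircle (2 * Real.pi * (m / T.sides f)) :=
  (Complex.arg ((v - T.center f) / (u - T.center f)) : ℝ)

lemma arg_vert_step (f : ι) (k : ℤ) (ε : ℤˣ) :
    Complex.arg ((T.vert f (k + ε) - T.center f) / (T.vert f k - T.center f)) =
      2 * Real.pi / T.sides f * ((k + ε : ℤ) : ℝ) - 2 * Real.pi / T.sides f * (k : ℝ) := by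
  have hp3 : (3 : ℝ) ≤ T.sides f := by exact_mod_cast T.three_le_sides f
  have hpi := Real.pi_pos
  have h : (T.vert f (k + ε) - T.center f) / (T.vert f k - T.center f) =
      Complex.exp ((2 * Real.pi / T.sides f * (ε : ℤ) : ℝ) * Complex.I) := by
    simp only [RegularPolygons.vert]
    rw [add_sub_cancel_left, add_sub_cancel_left, mul_div_mul_left _ _ (T.radius_ne_zero f),
      ← Complex.exp_sub]
    congr 1
    push_cast
    ring
  have hle : 2 * Real.pi / T.sides f < Real.pi := by
    rw [div_lt_iff₀ (by linarith)]
    nlinarith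
  have hlt : 0 < 2 * Real.pi / T.sides f := by positivity
  rw [h, ← Complex.log_im, Complex.log_exp]
  · simp only [Complex.im_ofReal_mul, Complex.I_im, mul_one]
    push_cast
    ring
  all_goals
    simp only [Complex.im_ofReal_mul, Complex.I_im, mul_one]
    rcases Int.units_eq_one_or ε with rfl | rfl <;> push_cast <;> linarith

lemma angleIncrement_vert_step (m : ℕ) (f : ι) (k : ℤ) (ε : ℤˣ) :
    T.angleIncrement m f (T.vert f k) (T.vert f (k + ε)) =
      (2 * Real.pi / T.sides f * ((k + ε : ℤ) : ℝ) : ℝ) -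
        (2 * Real.pi / T.sides f * (k : ℝ) : ℝ) := by
  rw [angleIncrement, arg_vert_step, AddCircle.coe_sub]

lemma isPeriodicCocycle_angleIncrement {m : ℕ} (hm : ∀ i, T.sides i ∣ m) (f : ι) :
    T.IsPeriodicCocycle m (T.angleIncrement m f) := by
  refine ⟨fun v => ?_, fun i => ?_⟩
  · by_cases h : v - T.center f = 0 <;> simp [angleIncrement, h]
  by_cases hi : i = f
  · subst hi
    refine ⟨fun k => (2 * Real.pi / T.sides i * (k : ℝ) : ℝ), 
      angleIncrement_vert_step m i, fun k ε => ?_⟩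
    · rw [← sub_eq_zero, ← AddCircle.coe_sub, AddCircle.coe_eq_zero_iff]
      refine ⟨ε, ?_⟩
      rw [zsmul_eq_mul]
      push_cast
      ring
  · obtain ⟨θ, hθ⟩ := exists_arg_div_eq_sub (T.convex_tile i) (T.isCompact_tile i).isClosed
      (T.center_notMem_tile (Ne.symm hi))
    refine ⟨fun k => (θ (T.vert i k) : ℝ), fun k ε => ?_, fun k ε => ?_⟩
    · rw [angleIncrement, hθ _ (T.vert_mem_tile i k) _ (T.vert_mem_tile i _), AddCircle.coe_sub]
    · obtain ⟨c, hc⟩ := hm i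
      have e : k + (m : ℤ) * (ε : ℤ) = k + T.sides i * (c * ε) := by rw [hc]; push_cast; ring
      simp only [e, T.vert_add_mul_sides]

end RegularPolygonTiling

/-! ### Words in the generators -/

/-- Every element of `[m, n]` is a product of the generators, which are involutions. -/
lemma CoxeterMN.induction {m n : ℕ} {P : CoxeterMN m n → Prop} (one : P 1)
    (rho_mul : ∀ i w, P w → P (CoxeterMN.rho m n i * w)) (w : CoxeterMN m n) : P w := by
  have hinv : ∀ i, (CoxeterMN.rho m n i)⁻¹ = CoxeterMN.rho m n i := by
    intro i
    rw [inv_eq_iff_mul_eq_one, ← sq]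
    have hmem : FreeGroup.of i ^ 2 ∈ coxeterRels m n := by
      fin_cases i <;> simp [coxeterRels]
    exact PresentedGroup.one_of_mem hmem
  have hw : w ∈ Subgroup.closure (Set.range (PresentedGroup.of (rels := coxeterRels m n))) := by
    rw [PresentedGroup.closure_range_of]
    exact Subgroup.mem_top w
  induction hw using Subgroup.closure_induction_left with
  | one => exact one
  | mul_left x hx y _ ih =>
    obtain ⟨i, rfl⟩ := hx
    exact rho_mul i y ih
  | inv_mul_cancel x hx y _ ih =>
    obtain ⟨i, rfl⟩ := hx
    have := rho_mul i y ih
    rwa [← hinv i] at this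

namespace RegularPolygonTiling

variable {ι : Type*} {T : RegularPolygonTiling ι}

/-! ### Connectedness of the flag graph -/

section Connected

variable {O : Set T.Flag} (hO : ∀ i Ψ Ψ', Ψ ∈ O → T.Adjacent i Ψ Ψ' → Ψ' ∈ O)
include hO

lemma mem_of_face_eq {Ψ Ψ' : T.Flag} (hΨ : Ψ ∈ O) (h : Ψ'.face = Ψ.face) : Ψ' ∈ O := by
  obtain ⟨k, ε, hk⟩ := T.exists_eq_flagAt Ψ
  obtain ⟨l, δ, hl⟩ := T.exists_eq_flagAt Ψ'
  rw [h] at hl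
  rw [hk] at hΨ
  rw [hl]
  set i := Ψ.face
  have hneg : ∀ (k : ℤ) (ε : ℤˣ), T.flagAt i k ε ∈ O → T.flagAt i k (-ε) ∈ O :=
    fun k ε hk => hO 1 _ _ hk (T.adjacent_one_flagAt i k ε)
  have hstep : ∀ (k : ℤ) (ε : ℤˣ), T.flagAt i k ε ∈ O → T.flagAt i (k + ε) ε ∈ O := by
    intro k ε hk
    have := hneg _ _ (hO 0 _ _ hk (T.adjacent_zero_flagAt i k ε))
    rwa [neg_neg] at this
  have hsign : ∀ (k : ℤ) (ε δ : ℤˣ), T.flagAt i k ε ∈ O → T.flagAt i k δ ∈ O := by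
    intro k ε δ hk
    have : δ = ε ∨ δ = -ε := by
      rcases Int.units_eq_one_or ε with rfl | rfl <;>
        rcases Int.units_eq_one_or δ with rfl | rfl <;> simp
    rcases this with rfl | rfl
    · exact hk
    · exact hneg _ _ hk
  refine hsign l 1 δ ?_
  clear hl
  induction l using Int.inductionOn' (b := k) with
  | zero => exact hsign k ε 1 hΨ
  | succ n _ ih => exact hstep n 1 ih
  | pred n _ ih => exact hsign _ _ _ (hstep n (-1) (hsign _ _ _ ih))

lemma HasVertexSymbol.mem_of_vertex_eq {p : List ℕ} (hT : T.HasVertexSymbol p)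
    (hp : 3 ≤ p.length) {Ψ Ψ' : T.Flag} (hΨ : Ψ ∈ O) (h : Ψ'.vertex = Ψ.vertex) : Ψ' ∈ O := by
  obtain ⟨A, B, hAB, hBA, hv⟩ := hT.exists_flags_at hp Ψ.vertex_mem_vertices
  have hBpow : ∀ j, B j ∈ O → ∀ k : ℕ, B ((finRotate p.length ^ k) j) ∈ O := by
    intro j hj k
    induction k with
    | zero => exact hj
    | succ k ih =>
      rw [pow_succ', Equiv.Perm.mul_apply]
      exact hO 1 _ _ (hO 2 _ _ ih (hBA _)) (hAB _)
  obtain ⟨j, hj⟩ := (hv Ψ).1 rfl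
  obtain ⟨j', hj'⟩ := (hv Ψ').1 h
  have hBj : B j ∈ O := by
    rcases hj with rfl | rfl
    · exact hO 1 _ _ hΨ (hAB j)
    · exact hΨ
  obtain ⟨k, rfl⟩ := exists_finRotate_pow_apply_eq j j'
  have hB := hBpow j hBj k
  rcases hj' with rfl | rfl
  · exact hO 1 _ _ hB (hAB _).symm
  · exact hB

/-- The flag graph is connected. A nonempty set of flags closed under adjacency contains all the
flags at each tile and at each vertex that it reaches, so the tiles it reaches and those it does not
reach cover two disjoint closed sets, whose union is the plane. -/
lemma HasVertexSymbol.mem_of_adjacent_closed {p : List ℕ} (hT : T.HasVertexSymbol p)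
    (hp : 3 ≤ p.length) {Φ : T.Flag} (hΦ : Φ ∈ O) (Ψ : T.Flag) : Ψ ∈ O := by
  set S : Set ι := {i | ∃ Ψ ∈ O, Ψ.face = i} with hS
  by_contra hΨ
  have hΨS : Ψ.face ∉ S := fun ⟨Ψ', hΨ', h⟩ => hΨ (mem_of_face_eq hO hΨ' h.symm)
  have hclosed : ∀ S : Set ι, IsClosed (⋃ i : S, T.tile i) := fun S =>
    (T.locallyFinite.comp_injective Subtype.val_injective).isClosed_iUnion
      fun i => (T.isCompact_tile i).isClosed
  have hcover : (Set.univ : Set ℂ) ⊆ (⋃ i : S, T.tile i) ∪ ⋃ i : (Sᶜ : Set ι), T.tile i := by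
    intro x _
    have hx : x ∈ ⋃ i, T.tile i := by rw [T.covers]; trivial
    obtain ⟨i, hi⟩ := Set.mem_iUnion.1 hx
    by_cases h : i ∈ S
    · exact Or.inl (Set.mem_iUnion.2 ⟨⟨i, h⟩, hi⟩)
    · exact Or.inr (Set.mem_iUnion.2 ⟨⟨i, h⟩, hi⟩)
  obtain ⟨x, -, hx, hx'⟩ := isPreconnected_closed_iff.1 isPreconnected_univ _ _ (hclosed S)
    (hclosed Sᶜ) hcover
    ⟨T.center Φ.face, trivial, Set.mem_iUnion.2 ⟨⟨Φ.face, Φ, hΦ, rfl⟩, T.center_mem_tile _⟩⟩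
    ⟨T.center Ψ.face, trivial, Set.mem_iUnion.2 ⟨⟨Ψ.face, hΨS⟩, T.center_mem_tile _⟩⟩
  obtain ⟨⟨i, Ψ₁, hΨ₁, rfl⟩, hi⟩ := Set.mem_iUnion.1 hx
  obtain ⟨⟨j, hj⟩, hj'⟩ := Set.mem_iUnion.1 hx'
  obtain ⟨v, ⟨k, hk⟩, ⟨l, hl⟩⟩ := T.exists_common_vertex ⟨x, hi, hj'⟩
  refine hj ⟨T.flagAt j l 1, hT.mem_of_vertex_eq hO hp (Ψ := T.flagAt Ψ₁.face k 1)
    (mem_of_face_eq hO hΨ₁ rfl) ?_, rfl⟩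
  exact hl.trans hk.symm

end Connected

/-! ### Infinitely many tiles with cone points -/

/-- If each vertex is on a tile with fewer than `m` sides, then there are infinitely many such
tiles. -/
lemma HasVertexSymbol.infinite_sides_lt {p : List ℕ} (hT : T.HasVertexSymbol p) {m : ℕ}
    (hpm : ∃ q ∈ p, q < m) : {f | T.sides f < m}.Infinite := by
  intro hfin
  obtain ⟨q, hq, hqm⟩ := hpm
  obtain ⟨j, rfl⟩ := List.get_of_mem hq
  have hV : (⋃ f ∈ {f | T.sides f < m}, Set.range (T.vert f)).Finite :=
    hfin.biUnion fun f _ => T.finite_range_vert f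
  have hv : ∀ i, T.vert i 0 ∈ ⋃ f ∈ {f | T.sides f < m}, Set.range (T.vert f) := by
    intro i
    obtain ⟨f, -, hrange, hs, -⟩ := hT (T.vert i 0) ⟨i, 0, rfl⟩
    have hj : f j ∈ {i' | T.vert i 0 ∈ Set.range (T.vert i')} := hrange ▸ ⟨j, rfl⟩
    refine Set.mem_biUnion (x := f j) ?_ hj
    rw [Set.mem_ofPred_eq, hs]
    exact hqm
  have hι : (Set.univ : Set ι).Finite := by
    refine ((hV.subset (Set.range_subset_iff.2 hv)).preimage' (f := fun i => T.vert i 0) ?_).subset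
      fun i _ => ⟨i, rfl⟩
    rintro _ ⟨i, rfl⟩
    obtain ⟨f, -, hrange, -, -⟩ := hT (T.vert i 0) ⟨i, 0, rfl⟩
    refine ((Set.finite_range f).subset ?_)
    rw [hrange]
    rintro i' hi'
    exact ⟨0, hi'⟩
  have : Finite ι := Set.finite_univ_iff.1 hι
  refine noncompact_univ ℂ ?_
  rw [← T.covers]
  exact isCompact_iUnion fun i => T.isCompact_tile i

/-! ### Paths of group elements and stabilizers of flags -/

section

variable {m n : ℕ} {σ : Fin 3 → Equiv.Perm T.Flag}
  {φ : CoxeterMN m n →* (Equiv.Perm T.Flag)ᵐᵒᵖ}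
  (hφ : ∀ i, φ (CoxeterMN.rho m n i) = MulOpposite.op (σ i))
include hφ

/-- The skew action lies over the flag action and commutes with translations of the fibre. -/
lemma exists_skewAction_eq {A : Type*} [AddCommGroup A] {d : ℂ → ℂ → A}
    {ψ : CoxeterMN m n →* (Equiv.Perm (T.Flag × A))ᵐᵒᵖ}
    (hψ : ∀ i, ψ (CoxeterMN.rho m n i) = MulOpposite.op (skewPerm d (σ i)))
    (w : CoxeterMN m n) :
    ∀ Ψ : T.Flag, ∃ a, ∀ t, (ψ w).unop (Ψ, t) = ((φ w).unop Ψ, t + a) := by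
  induction w using CoxeterMN.induction with
  | one => exact fun Ψ => ⟨0, fun t => by simp⟩
  | rho_mul i w ih =>
    intro Ψ
    obtain ⟨a, ha⟩ := ih (σ i Ψ)
    refine ⟨d Ψ.vertex (σ i Ψ).vertex + a, fun t => ?_⟩
    rw [map_mul, map_mul, hψ, hφ, MulOpposite.unop_mul, MulOpposite.unop_mul, MulOpposite.unop_op,
      MulOpposite.unop_op, Equiv.Perm.mul_apply, Equiv.Perm.mul_apply, skewPerm_apply, ha,
      add_assoc]

/-- The path of a given group element from a given flag stays in a bounded region. If the increments
have a potential `θ` there, then the path changes the second component by the difference of `θ`. -/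
lemma exists_radius (w : CoxeterMN m n) : ∀ Ψ : T.Flag, ∃ R : ℝ,
    ∀ {A : Type} [AddCommGroup A] (d : ℂ → ℂ → A)
      (ψ : CoxeterMN m n →* (Equiv.Perm (T.Flag × A))ᵐᵒᵖ)
      (_ : ∀ i, ψ (CoxeterMN.rho m n i) = MulOpposite.op (skewPerm d (σ i))) (θ : ℂ → A)
      (_ : ∀ u v : ℂ, ‖u‖ ≤ R → ‖v‖ ≤ R → d u v = θ v - θ u) (t : A),
      (ψ w).unop (Ψ, t) =
        ((φ w).unop Ψ, t + (θ ((φ w).unop Ψ).vertex - θ Ψ.vertex)) := by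
  induction w using CoxeterMN.induction with
  | one => exact fun Ψ => ⟨0, fun d ψ hψ θ hθ t => by simp⟩
  | rho_mul i w ih =>
    intro Ψ
    obtain ⟨R, hR⟩ := ih (σ i Ψ)
    refine ⟨max R (max ‖Ψ.vertex‖ ‖(σ i Ψ).vertex‖), fun d ψ hψ θ hθ t => ?_⟩
    have h1 := hR d ψ hψ θ fun u v hu hv =>
      hθ u v (hu.trans (le_max_left _ _)) (hv.trans (le_max_left _ _))
    have h2 := hθ Ψ.vertex (σ i Ψ).vertex ((le_max_left _ _).trans (le_max_right _ _))
      ((le_max_right _ _).trans (le_max_right _ _))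
    rw [map_mul, map_mul, hψ, hφ, MulOpposite.unop_mul, MulOpposite.unop_mul, MulOpposite.unop_op,
      MulOpposite.unop_op, Equiv.Perm.mul_apply, Equiv.Perm.mul_apply, skewPerm_apply, h1, h2]
    refine Prod.ext rfl ?_
    simp only
    abel

end

/-- If `q < m` for some `q` in the symbol, then the stabilizer of a flag is not finitely generated:
given finitely many elements of it, some tile has winding numbers that vanish, modulo `m / sides`
turns, on these elements but not on the whole stabilizer. -/
lemma HasVertexSymbol.not_fg_flagStabilizer {p : List ℕ} (hT : T.HasVertexSymbol p)
    (hp : 3 ≤ p.length) {m : ℕ} (hpm : ∀ q ∈ p, q ∣ m) (hlt : ∃ q ∈ p, q < m)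
    (φ : CoxeterMN m p.length →* (Equiv.Perm T.Flag)ᵐᵒᵖ) (hφ : T.IsFlagAction φ) (Φ : T.Flag) :
    ¬ (T.flagStabilizer φ Φ).FG := by
  rintro ⟨S, hS⟩
  obtain ⟨σ, hσ⟩ := hT.exists_perm hp
  have hφσ : ∀ i, φ (CoxeterMN.rho m p.length i) = MulOpposite.op (σ i) := fun i =>
    MulOpposite.unop_injective (Equiv.ext fun Ψ => ((hσ i Ψ _).1 (hφ i Ψ)).symm)
  choose R hR using fun w => exists_radius hφσ w Φ
  obtain ⟨R₀, hR₀⟩ := (S.finite_toSet.image R).bddAbove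
  -- a tile with fewer than `m` sides, whose centre is far from the paths of the generators
  obtain ⟨f, hfm, hfR⟩ := ((hT.infinite_sides_lt hlt).sdiff
    (T.locallyFinite.finite_nonempty_inter_compact
      (isCompact_closedBall (0 : ℂ) R₀))).nonempty
  have hfc : T.center f ∉ Metric.closedBall (0 : ℂ) R₀ := fun h =>
    hfR ⟨T.center f, T.center_mem_tile f, h⟩
  have hd := isPeriodicCocycle_angleIncrement (hT.sides_dvd hpm) f
  obtain ⟨ψ, hψ⟩ := exists_skewAction hσ hd hT hp (hT.sides_dvd hpm)
  obtain ⟨θ, hθ⟩ := exists_arg_div_eq_sub (convex_closedBall (0 : ℂ) R₀)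
    Metric.isClosed_closedBall hfc
  have hstab : ∀ w ∈ T.flagStabilizer φ Φ, (ψ w).unop (Φ, 0) = (Φ, 0) := by
    intro w hw
    rw [← hS] at hw
    induction hw using Subgroup.closure_induction with
    | mem s hs =>
      have hsΦ : (φ s).unop Φ = Φ := by
        have : s ∈ T.flagStabilizer φ Φ := hS ▸ Subgroup.subset_closure hs
        exact this
      have hRs : R s ≤ R₀ := hR₀ ⟨s, hs, rfl⟩
      rw [hR s _ ψ hψ (fun v => (θ v : ℝ)), hsΦ, sub_self, add_zero]
      intro u v hu hv
      rw [angleIncrement, hθ u (by simpa using hu.trans hRs) v (by simpa using hv.trans hRs),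
        AddCircle.coe_sub]
    | one => simp
    | mul x y _ _ hx hy => rw [map_mul, MulOpposite.unop_mul, Equiv.Perm.mul_apply, hx, hy]
    | inv x _ hx => rw [map_inv, MulOpposite.unop_inv, Equiv.Perm.inv_eq_iff_eq, hx]
  -- a path from `Φ` to the tile `f`
  obtain ⟨w, hw⟩ : ∃ w, (φ w).unop Φ = T.flagAt f 0 1 := by
    refine hT.mem_of_adjacent_closed (O := {Ψ | ∃ w, (φ w).unop Φ = Ψ}) ?_ hp
      (Φ := Φ) ⟨1, by simp⟩ (T.flagAt f 0 1)
    rintro i _ Ψ' ⟨w, rfl⟩ h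
    refine ⟨w * CoxeterMN.rho m p.length i, ?_⟩
    rw [map_mul, MulOpposite.unop_mul, Equiv.Perm.mul_apply, hφσ]
    exact (hσ _ _ _).1 h
  -- the path, one turn around `f`, and back
  set g := w * (CoxeterMN.rho m p.length 0 * CoxeterMN.rho m p.length 1) ^ T.sides f * w⁻¹
  have hg : (ψ g).unop (Φ, 0) = (Φ, ((2 * Real.pi : ℝ) : AddCircle _)) := by
    obtain ⟨a, ha⟩ := exists_skewAction_eq hφσ hψ w Φ
    have hsides : (T.sides f : ℝ) ≠ 0 := by exact_mod_cast (T.sides_pos f).ne'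
    simp only [g, map_mul, map_pow, map_inv, MulOpposite.unop_mul, MulOpposite.unop_inv,
      MulOpposite.unop_pow, Equiv.Perm.mul_apply, hψ, MulOpposite.unop_op]
    rw [Equiv.Perm.inv_eq_iff_eq, ha, ha, hw,
      skewPerm_zero_one_pow hσ hd (angleIncrement_vert_step m f)]
    have e : (0 : ℤ) + (T.sides f : ℤ) * ((1 : ℤˣ) : ℤ) = 0 + T.sides f * 1 := by simp
    rw [e]
    refine Prod.ext (T.flagAt_add_mul_sides f 0 1 1) ?_
    simp only [← AddCircle.coe_sub]
    rw [zero_add, add_comm]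
    congr 2
    push_cast
    field_simp
    ring
  have hgmem : g ∈ T.flagStabilizer φ Φ := by
    obtain ⟨a, ha⟩ := exists_skewAction_eq hφσ hψ g Φ
    exact congrArg Prod.fst ((ha 0).symm.trans hg)
  have h0 := congrArg Prod.snd (hg.symm.trans (hstab g hgmem))
  obtain ⟨n, hn⟩ := (AddCircle.coe_eq_zero_iff _).1 h0
  -- `n * (m / sides f) = 1`, although `sides f < m`
  have hsides : (T.sides f : ℝ) ≠ 0 := by exact_mod_cast (T.sides_pos f).ne'
  have hpi := Real.pi_ne_zero
  rw [zsmul_eq_mul] at hn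
  field_simp at hn
  have hn' : n * (m : ℤ) = T.sides f := by exact_mod_cast hn
  have hle := Int.le_of_dvd (by exact_mod_cast T.sides_pos f) (Dvd.intro_left n hn')
  have hfm' : T.sides f < m := hfm
  omega

end RegularPolygonTiling

lemma three_le_length_of_mem_uniformSymbols {p : List ℕ} (hp : p ∈ uniformSymbols) :
    3 ≤ p.length := by
  revert p
  decide

lemma exists_mem_lt_mem_of_mem_uniformSymbols {p : List ℕ} (hp : p ∈ uniformSymbols) :
    ∃ q ∈ p, ∃ r ∈ p, q < r := by
  revert p
  decide

end

theorem theorem3p3 {ι : Type*} (T : RegularPolygonTiling ι) (p : List ℕ) (hT : T.IsUniform p)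
    (m : ℕ) (hm : 0 < m) (hpm : ∀ q ∈ p, q ∣ m) :
    (∃ φ : CoxeterMN m p.length →* (Equiv.Perm T.Flag)ᵐᵒᵖ, T.IsFlagAction φ) ∧
    ∀ φ : CoxeterMN m p.length →* (Equiv.Perm T.Flag)ᵐᵒᵖ, T.IsFlagAction φ →
      ∀ Φ : T.Flag, ¬ (T.flagStabilizer φ Φ).FG := by
  obtain ⟨hp, -, hsym⟩ := hT
  have h3 := three_le_length_of_mem_uniformSymbols hp
  obtain ⟨q, hq, r, hr, hqr⟩ := exists_mem_lt_mem_of_mem_uniformSymbols hp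
  exact ⟨hsym.exists_isFlagAction h3 hpm, hsym.not_fg_flagStabilizer h3 hpm
    ⟨q, hq, hqr.trans_le (Nat.le_of_dvd hm (hpm r hr))⟩⟩
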